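/- Let $\Pi_2(q^2)$ denote the projective plane over the finite field $GF(q^2)$. A pencil in it is the set of all lines through a fixed point $P$, called the center. A pencil arc with respect to this pencil is a set $\mathcal K$ of points, not containing $P$, such that any three distinct points of $\mathcal K$ which are not all contained in a single line of the pencil are linearly independent (i.e. not collinear). A regular $(m,h)$-parc in $\Pi_2(q^2)$ is a pencil arc $\mathcal K$, with respect to some pencil, such that exactly $h$ points of $\mathcal K$ lie on each of some $m$ of the $q^2+1$ lines of the pencil and no point of $\mathcal K$ lies on any of the remaining lines of the pencil. Theorem. For every even prime power $q$, the plane $\Pi_2(q^2)$ contains (a) a regular $(q+1,\,q)$-parc, and (b) a regular $\left(\frac{q+2}{2},\,2q\right)$-parc. -/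

import Mathlib

open scoped LinearAlgebra.Projectivization

/-- The projective space `Π_r(q)` over a field `F` (with `q` elements): nonzero `(r+1)`-tuples of
elements of `F` up to nonzero scalar multiples. -/
abbrev ProjSpace (r : ℕ) (F : Type*) [Field F] : Type _ := ℙ F (Fin (r + 1) → F)

/-- The linear dimension (projective dimension plus one) of a projective subspace. -/
noncomputable def linDim {r : ℕ} {F : Type*} [Field F]
    (W : Projectivization.Subspace F (Fin (r + 1) → F)) : ℕ :=
  Module.finrank F (Projectivization.Subspace.submodule W)

/-- A set of points of `Π_r` is `t`-independent if any `t` distinct points of it are linearly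
independent. -/
def IsIndepSet {r : ℕ} {F : Type*} [Field F] (t : ℕ) (K : Set (ProjSpace r F)) : Prop :=
  ∀ p : Fin t → ProjSpace r F, Function.Injective p → (∀ i, p i ∈ K) →
    Projectivization.Independent p

/-- The pencil with axis `C` in `Π_r`: the set of all hyperplanes (projective subspaces of
dimension `r - 1`) containing `C`. It is a pencil when `C` has projective dimension `r - 2`;
for `r = 2`, `C` is a point and the pencil is the set of lines through it. -/
def pencil {r : ℕ} {F : Type*} [Field F] (C : Projectivization.Subspace F (Fin (r + 1) → F)) :
    Set (Projectivization.Subspace F (Fin (r + 1) → F)) :=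
  {H | linDim H = r ∧ C ≤ H}

/-- `K` is a pencil arc in `Π_r` with respect to the pencil with axis `C`. -/
structure IsPencilArc {r : ℕ} {F : Type*} [Field F]
    (C : Projectivization.Subspace F (Fin (r + 1) → F)) (K : Set (ProjSpace r F)) : Prop where
  /-- the axis has projective dimension `r - 2` -/
  axis_dim : linDim C + 2 = r + 1
  /-- each section of `K` by a hyperplane `Π_{r-1}` of the pencil is an arc in `Π_{r-1}` -/
  section_arc : ∀ H ∈ pencil C, IsIndepSet r (K ∩ (H : Set (ProjSpace r F)))
  /-- distinct hyperplanes of the pencil have no common point in `K` -/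
  disjoint_sections : ∀ H ∈ pencil C, ∀ H' ∈ pencil C, H ≠ H' →
    K ∩ (H : Set (ProjSpace r F)) ∩ (H' : Set (ProjSpace r F)) = ∅
  /-- any `r + 1` distinct points of `K` not contained in a single hyperplane of the pencil are
  independent -/
  independent : ∀ p : Fin (r + 1) → ProjSpace r F, Function.Injective p → (∀ i, p i ∈ K) →
    (¬ ∃ H ∈ pencil C, ∀ i, p i ∈ H) → Projectivization.Independent p

/-- `K` is a regular `(m, h)`-parc in `Π_r`: a pencil arc for some pencil such that `m` of the
hyperplanes of the pencil meet `K` in exactly `h` points each and all the others are disjoint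
from `K`. -/
def IsRegularParc {r : ℕ} {F : Type*} [Field F] (m h : ℕ) (K : Set (ProjSpace r F)) : Prop :=
  ∃ C : Projectivization.Subspace F (Fin (r + 1) → F), IsPencilArc C K ∧
    ∃ S ⊆ pencil C, S.encard = m ∧
      (∀ H ∈ S, (K ∩ (H : Set (ProjSpace r F))).encard = h) ∧
      (∀ H ∈ pencil C, H ∉ S → K ∩ (H : Set (ProjSpace r F)) = ∅)

/-!
Let `q` be a power of `2`, let `T y = y ^ q + y` be the trace from `F = GF(q²)` to its subfield
`GF(q)`, and let `g y = (T y)² + c * T y` with `c ∈ {0, 1}`, an additive map. The parcs are the sets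
`{(1 : g y : y) | y ∈ F} ∪ {(0 : 1 : y) | g y = 0}`, with centre `(0 : 0 : 1)`.

Applying `T` to the last coordinates gives the points `(1 : t² + c t : t)` for `t ∈ GF(q)` and
`(0 : 1 : t)` for `t ∈ {0, c}`. For `c = 0` they form a conic whose nucleus is the centre, so each
line through the centre in the Baer subplane has exactly one of them. For `c = 1` they form a
hyperoval that misses the centre, so each of these lines has none or two of them. The first two
coordinates lie in `GF(q)`, so if three points of the parc in distinct directions were collinear,
then applying `T` to their determinant would make their images collinear too, which is impossible
(`det_ne_zero_of_averaging`). Three points with exactly two on one line of the pencil are never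
collinear (`det_dirVec_ne_zero_of_eq`).

The line in direction `d` meets the parc in a fibre of `g`, hence in `|ker g|` points or none
(`exists_isRegularParc_of_averaging`), and the number of lines meeting it is `|range g| + 1`, the
extra one being `(0 : 1)`. Since `T` has kernel and range of size `q`, the map `g` has a kernel of
size `q` for `c = 0` and `2 q` for `c = 1`.
-/

/-! ### The pencil with centre `(0 : 0 : 1)` -/

/-- The vector with first two coordinates in direction `d` (where `some d` is `(1, d)` and `none` is
`(0, 1)`, so that `Option F` is the projective line) and with last coordinate `y`. -/
def dirVec {F : Type*} [Field F] (d : Option F) (y : F) : Fin (2 + 1) → F :=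
  d.elim ![0, 1, y] fun a => ![1, a, y]

theorem dirVec_ne_zero {F : Type*} [Field F] (d : Option F) (y : F) : dirVec d y ≠ 0 := by
  intro h
  cases d with
  | none => simpa [dirVec] using congrFun h 1
  | some a => simpa [dirVec] using congrFun h 0

/-- The point of the plane represented by `dirVec d y`. These are all the points other than
`(0 : 0 : 1)`. -/
def dirPoint {F : Type*} [Field F] (d : Option F) (y : F) : ProjSpace 2 F :=
  Projectivization.mk F (dirVec d y) (dirVec_ne_zero d y)

/-- If the point with vector `dirVec d y` lies on the line joining `(0 : 0 : 1)` to the point with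
vector `dirVec e z`, then the directions agree; the normalization of `dirVec` forces `b = 1`. -/
theorem dirVec_eq_smul {F : Type*} [Field F] {d e : Option F} {y z a b : F}
    (h : a • ![0, 0, 1] + b • dirVec e z = dirVec d y) : d = e ∧ b = 1 := by
  have h0 := congrFun h 0
  have h1 := congrFun h 1
  cases d <;> cases e <;> simp [dirVec] at h0 h1
  · exact ⟨rfl, h1⟩
  · simp [h0] at h1
  · subst h0
    exact ⟨by simpa using h1.symm, rfl⟩

theorem dirPoint_injective {F : Type*} [Field F] (d : Option F) :
    Function.Injective (dirPoint d) := by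
  intro y z h
  obtain ⟨b, hb⟩ := (Projectivization.mk_eq_mk_iff' F _ _ _ _).1 h
  obtain ⟨-, rfl⟩ := dirVec_eq_smul (a := (0 : F)) (by simpa using hb)
  have h2 := congrFun hb 2
  cases d <;> simpa [dirVec] using h2.symm

/-- The point `(0 : 0 : 1)`, as a projective subspace. -/
def centre (F : Type*) [Field F] : Projectivization.Subspace F (Fin (2 + 1) → F) :=
  (Submodule.span F {![0, 0, 1]}).projectivization

/-- The line through `(0 : 0 : 1)` in direction `d`. -/
def dirLine {F : Type*} [Field F] (d : Option F) : Projectivization.Subspace F (Fin (2 + 1) → F) :=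
  (Submodule.span F {![0, 0, 1], dirVec d 0}).projectivization

theorem linDim_centre (F : Type*) [Field F] : linDim (centre F) = 1 := by
  rw [linDim, centre, OrderIso.apply_symm_apply]
  refine finrank_span_singleton fun h => one_ne_zero (α := F) ?_
  simpa using congrFun h 2

theorem finrank_span_dirVec {F : Type*} [Field F] (d : Option F) (y : F) :
    Module.finrank F (Submodule.span F {![0, 0, 1], dirVec d y}) = 2 := by
  have h : LinearIndependent F ![![0, 0, 1], dirVec d y] := by
    rw [LinearIndependent.pair_iff]
    intro s t h
    have h0 := congrFun h 0
    have h1 := congrFun h 1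
    have h2 := congrFun h 2
    cases d <;> simp [dirVec] at h0 h1 h2 <;> simp_all
  have := finrank_span_eq_card h
  rwa [Matrix.range_cons, Matrix.range_cons, Matrix.range_empty, Set.union_empty,
    Set.singleton_union, Fintype.card_fin] at this

theorem dirLine_mem_pencil {F : Type*} [Field F] (d : Option F) :
    dirLine d ∈ pencil (centre F) := by
  refine ⟨?_, ?_⟩
  · rw [linDim, dirLine, OrderIso.apply_symm_apply]
    exact finrank_span_dirVec d 0
  · exact (OrderIso.le_iff_le _).2 (Submodule.span_mono (by simp))

theorem dirPoint_mem_dirLine {F : Type*} [Field F] {d e : Option F} {y : F} :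
    dirPoint d y ∈ dirLine e ↔ d = e := by
  rw [dirPoint, dirLine, Submodule.mk_mem_projectivization_iff, Submodule.mem_span_pair]
  constructor
  · rintro ⟨a, b, h⟩
    exact (dirVec_eq_smul h).1
  · rintro rfl
    refine ⟨y, 1, ?_⟩
    cases d <;> ext i <;> fin_cases i <;> simp [dirVec]

theorem dirLine_injective {F : Type*} [Field F] :
    Function.Injective (dirLine : Option F → _) := by
  intro d e h
  rw [← dirPoint_mem_dirLine (y := 0), ← h, dirPoint_mem_dirLine]

/-- A line of the pencil is determined by any one of its points other than the centre. -/
theorem eq_dirLine_of_mem_pencil {F : Type*} [Field F]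
    {H : Projectivization.Subspace F (Fin (2 + 1) → F)} (hH : H ∈ pencil (centre F))
    {d : Option F} {y : F} (hd : dirPoint d y ∈ H) : H = dirLine d := by
  have key : ∀ H' ∈ pencil (centre F), dirPoint d y ∈ H' →
      Projectivization.Subspace.submodule H' = Submodule.span F {![0, 0, 1], dirVec d y} := by
    intro H' hH' hd'
    refine (Submodule.eq_of_le_of_finrank_eq ?_ ?_).symm
    · have hC : Submodule.span F {![0, 0, 1]} ≤ Projectivization.Subspace.submodule H' :=
        (OrderIso.symm_apply_le _).1 hH'.2
      rw [Submodule.span_le, Set.insert_subset_iff, Set.singleton_subset_iff]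
      exact ⟨hC (Submodule.mem_span_singleton_self _),
        (Projectivization.Subspace.mem_submodule_iff H' (dirVec_ne_zero d y)).2 hd'⟩
    · rw [finrank_span_dirVec]
      exact hH'.1.symm
  exact Projectivization.Subspace.submodule.injective ((key H hH hd).trans
    (key _ (dirLine_mem_pencil d) (dirPoint_mem_dirLine.2 rfl)).symm)

/-- The determinant of three vectors with two in the same direction factors, so that only triples in
pairwise distinct directions need a hypothesis. -/
theorem det_dirVec_ne_zero_of_eq {F : Type*} [Field F] {d e : Option F} {x y z : F} (hde : d ≠ e)
    (hxy : x ≠ y) : (Matrix.of ![dirVec d x, dirVec d y, dirVec e z]).det ≠ 0 := by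
  have h := sub_ne_zero.2 hxy
  cases d <;> cases e <;> simp [dirVec, Matrix.det_fin_three] at hde ⊢
  · contrapose! h
    linear_combination -h
  · contrapose! h
    linear_combination h
  · rename_i a b
    have : (x - y) * (a - b) ≠ 0 := mul_ne_zero h (sub_ne_zero.2 hde)
    contrapose! this
    linear_combination -this

/-! ### Regular parcs from sets of last coordinates -/

/-- A choice of a set `A d` of `h` last coordinates on each of `m` lines through `(0 : 0 : 1)` is a
regular parc as soon as no three chosen points in distinct directions are collinear. -/
theorem isRegularParc_of_det {F : Type*} [Field F] (A : Option F → Set F) (D : Set (Option F))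
    {m h : ℕ} (hD : D.encard = m) (hA : ∀ d ∈ D, (A d).encard = h) (hA' : ∀ d ∉ D, A d = ∅)
    (hdet : ∀ d₀ d₁ d₂ : Option F, d₀ ≠ d₁ → d₁ ≠ d₂ → d₂ ≠ d₀ →
      ∀ y₀ ∈ A d₀, ∀ y₁ ∈ A d₁, ∀ y₂ ∈ A d₂,
        (Matrix.of ![dirVec d₀ y₀, dirVec d₁ y₁, dirVec d₂ y₂]).det ≠ 0) :
    IsRegularParc m h {p : ProjSpace 2 F | ∃ d, ∃ y ∈ A d, p = dirPoint d y} := by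
  refine ⟨centre F, ⟨by rw [linDim_centre], ?_, ?_, ?_⟩, dirLine '' D, ?_, ?_, ?_, ?_⟩
  · intro H _ p hp _
    have := (Projectivization.independent_pair_iff_ne (p 0) (p 1)).2 (hp.ne (by decide))
    convert this using 1
    ext i
    fin_cases i <;> rfl
  · rintro H hH H' hH' hne
    rw [Set.eq_empty_iff_forall_notMem]
    rintro _ ⟨⟨⟨d, y, -, rfl⟩, h1⟩, h2⟩
    exact hne ((eq_dirLine_of_mem_pencil hH h1).trans (eq_dirLine_of_mem_pencil hH' h2).symm)
  · intro p hp hpK hline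
    choose d y hy hpd using hpK
    obtain rfl : p = fun i => dirPoint (d i) (y i) := funext hpd
    have hne : ¬ (d 0 = d 1 ∧ d 1 = d 2) := by
      rintro ⟨h1, h2⟩
      refine hline ⟨dirLine (d 0), dirLine_mem_pencil _, fun i => dirPoint_mem_dirLine.2 ?_⟩
      fin_cases i
      exacts [rfl, h1.symm, (h1.trans h2).symm]
    have hyne : ∀ i j, i ≠ j → d i = d j → y i ≠ y j := fun i j hij hd hyij =>
      hij (hp (by simp only [hd, hyij]))
    refine Projectivization.Independent.mk (fun i => dirVec (d i) (y i)) _ ?_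
    have hM : (Matrix.of fun i => dirVec (d i) (y i)) =
        Matrix.of ![dirVec (d 0) (y 0), dirVec (d 1) (y 1), dirVec (d 2) (y 2)] := by
      ext i j
      fin_cases i <;> rfl
    have hdet' : (Matrix.of fun i => dirVec (d i) (y i)).det ≠ 0 := by
      rw [hM]
      by_cases h01 : d 0 = d 1
      · rw [← h01]
        exact det_dirVec_ne_zero_of_eq (fun h => hne ⟨h01, h01 ▸ h⟩) (hyne 0 1 (by decide) h01)
      by_cases h12 : d 1 = d 2
      · have := det_dirVec_ne_zero_of_eq (z := y 0) (Ne.symm h01) (hyne 1 2 (by decide) h12)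
        rw [← h12]
        contrapose! this
        rw [Matrix.det_fin_three] at this ⊢
        simp at this ⊢
        linear_combination this
      by_cases h20 : d 2 = d 0
      · have := det_dirVec_ne_zero_of_eq (z := y 1) (fun h => h12 h.symm)
          (hyne 2 0 (by decide) h20)
        rw [← h20]
        contrapose! this
        rw [Matrix.det_fin_three] at this ⊢
        simp at this ⊢
        linear_combination this
      exact hdet _ _ _ h01 h12 h20 _ (hy 0) _ (hy 1) _ (hy 2)
    exact Matrix.linearIndependent_rows_of_det_ne_zero hdet'
  · rintro _ ⟨d, -, rfl⟩
    exact dirLine_mem_pencil d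
  · rw [dirLine_injective.encard_image, hD]
  · rintro _ ⟨d, hd, rfl⟩
    rw [← hA d hd, ← (dirPoint_injective d).encard_image]
    congr 1
    ext p
    constructor
    · rintro ⟨⟨e, y, hy, rfl⟩, hp⟩
      obtain rfl := dirPoint_mem_dirLine.1 hp
      exact ⟨y, hy, rfl⟩
    · rintro ⟨y, hy, rfl⟩
      exact ⟨⟨d, y, hy, rfl⟩, dirPoint_mem_dirLine.2 rfl⟩
  · intro H hH hHS
    rw [Set.eq_empty_iff_forall_notMem]
    rintro _ ⟨⟨d, y, hy, rfl⟩, hp⟩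
    refine hHS ⟨d, ?_, (eq_dirLine_of_mem_pencil hH hp).symm⟩
    by_contra hd
    simp [hA' d hd] at hy

/-! ### The construction from an averaging map -/

/-- A nonempty fibre of an additive map is a coset of the kernel. -/
theorem encard_preimage_singleton {G : Type*} [AddCommGroup G] [Finite G] (g : G →+ G) (x : G) :
    {y | g y = g x}.encard = Nat.card g.ker := by
  have h : {y | g y = g x} = (fun y => y + x) '' (g.ker : Set G) := by
    ext y
    constructor
    · intro hy
      exact ⟨y - x, by simpa [AddMonoidHom.mem_ker, sub_eq_zero] using hy, by simp⟩
    · rintro ⟨k, hk, rfl⟩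
      have : g k = 0 := hk
      simp [this]
  rw [h, (add_left_injective x).encard_image, ← Set.Finite.cast_ncard_eq (Set.toFinite _)]
  rfl

/-- Sending `∞` to `0`, the directions over `R ∋ 0` number one more than the elements of `R`. -/
theorem encard_getD_mem {F : Type*} [Zero F] {R : Set F} (hR : R.Finite) (h0 : (0 : F) ∈ R) :
    {d : Option F | d.getD 0 ∈ R}.encard = (R.ncard + 1 : ℕ) := by
  have h : {d : Option F | d.getD 0 ∈ R} = insert none (some '' R) := by
    ext d
    cases d <;> simp [h0]
  rw [h, Set.encard_insert_of_notMem (by simp), (Option.some_injective F).encard_image,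
    ← hR.cast_ncard_eq]
  rfl

/-- Let `T` be additive and linear over its own values, `c ∈ {0, 1}` and `g = T² + cT`. Three points
in distinct directions whose last coordinates have `g` equal to the direction (with `∞` read as `0`)
are not collinear. Applying `T` to the last column of the determinant keeps the other two columns and
turns it into the determinant of points of a hyperoval: a Vandermonde determinant when all
directions are finite. -/
theorem det_ne_zero_of_averaging {F : Type*} [Field F] [CharP F 2] (T g : F →+ F)
    (hT : ∀ x y, T (T x * y) = T x * T y) {c : F} (hc : c = 0 ∨ c = 1)
    (hg : ∀ y, g y = T y * T y + c * T y) {d₀ d₁ d₂ : Option F} (h01 : d₀ ≠ d₁) (h12 : d₁ ≠ d₂)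
    (h20 : d₂ ≠ d₀) {y₀ y₁ y₂ : F} (h₀ : g y₀ = d₀.getD 0) (h₁ : g y₁ = d₁.getD 0)
    (h₂ : g y₂ = d₂.getD 0) :
    (Matrix.of ![dirVec d₀ y₀, dirVec d₁ y₁, dirVec d₂ y₂]).det ≠ 0 := by
  have two : (2 : F) = 0 := CharTwo.two_eq_zero
  have hTg : ∀ x y, T (g x * y) = g x * T y := by
    intro x y
    have h1 : T (T x * T x * y) = T x * T x * T y := by rw [mul_assoc, hT, hT, mul_assoc]
    rcases hc with rfl | rfl
    · rw [hg, zero_mul, add_zero, h1]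
    · rw [hg, one_mul, add_mul, map_add, h1, hT]
      ring
  have hTg' : ∀ x y, T x = T y → g x = g y := fun x y h => by rw [hg, hg, h]
  -- Here `x` is the last coordinate of a point in direction `∞`, so that `T x ∈ {0, c}`.
  have hinf : ∀ x y z, g x = 0 → y - z + (g z - g y) * x = 0 → g y = g z := by
    intro x y z hx h
    have h' := congrArg T h
    rw [map_add, map_sub, sub_mul, map_sub, hTg, hTg, map_zero] at h'
    rw [hg] at hx
    refine hTg' _ _ ?_
    have hx' : T x = 0 ∨ T x = 1 ∧ c = 1 := by
      rcases hc with rfl | rfl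
      · exact Or.inl (by simpa using hx)
      · refine (mul_eq_zero.1 (show T x * (T x + 1) = 0 by linear_combination hx)).imp_right
          fun h => ⟨?_, rfl⟩
        linear_combination h - two
    rcases hx' with hx' | ⟨hx', rfl⟩
    · rw [hx'] at h'
      linear_combination h'
    · rw [hx', hg, hg] at h'
      have : (T y - T z) ^ 2 = 0 := by
        linear_combination -h' + (T z ^ 2 - T y * T z) * two
      exact sub_eq_zero.1 (pow_eq_zero_iff two_ne_zero |>.1 this)
  intro hdet
  rw [Matrix.det_fin_three] at hdet
  cases d₀ <;> cases d₁ <;> cases d₂ <;> simp [dirVec] at h01 h12 h20 h₀ h₁ h₂ hdet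
  · refine h12 ?_
    rw [← h₁, ← h₂] at hdet ⊢
    exact hinf _ _ _ h₀ (by linear_combination hdet)
  · refine h20 ?_
    rw [← h₀, ← h₂] at hdet ⊢
    exact hinf _ _ _ h₁ (by linear_combination hdet)
  · refine h01 ?_
    rw [← h₁, ← h₀] at hdet ⊢
    exact hinf _ _ _ h₂ (by linear_combination hdet)
  -- Three finite directions: a Vandermonde determinant in `T y₀`, `T y₁`, `T y₂`.
  · subst h₀ h₁ h₂
    have h' : T (g y₁ * y₂ - g y₂ * y₁ - g y₀ * y₂ + g y₂ * y₀ + g y₀ * y₁ - g y₁ * y₀) = 0 := by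
      rw [← map_zero T]
      congr 1
      linear_combination hdet
    simp only [map_add, map_sub, hTg] at h'
    have : (T y₀ - T y₁) * ((T y₁ - T y₂) * (T y₂ - T y₀)) = 0 := by
      simp only [hg] at h'
      linear_combination -h'
    simp only [mul_eq_zero, sub_eq_zero] at this
    rcases this with h | h | h
    exacts [h01 (hTg' _ _ h), h12 (hTg' _ _ h), h20 (hTg' _ _ h)]

theorem card_range_mul_card_ker {G : Type*} [AddCommGroup G] (g : G →+ G) :
    Nat.card g.range * Nat.card g.ker = Nat.card G := by
  rw [← AddSubgroup.index_ker, AddSubgroup.index_mul_card]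

/-- The set `{(1 : g y : y)} ∪ {(0 : 1 : y) | g y = 0}` for `g = T² + cT` is a regular parc. Its
sections are cosets of `ker g`, and they lie over the elements of `range g` and over `∞`. -/
theorem exists_isRegularParc_of_averaging {F : Type*} [Field F] [Finite F] [CharP F 2]
    (T : F →+ F) (hT : ∀ x y, T (T x * y) = T x * T y) {c : F} (hc : c = 0 ∨ c = 1) {m h : ℕ}
    (hh : {y | T y * T y + c * T y = 0}.ncard = h) (hm : m * h = Nat.card F) :
    ∃ K : Set (ProjSpace 2 F), IsRegularParc (m + 1) h K := by
  let g : F →+ F := AddMonoidHom.mk' (fun y => T y * T y + c * T y) fun x y => by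
    rw [map_add]
    linear_combination T x * T y * (CharTwo.two_eq_zero : (2 : F) = 0)
  have hker : Nat.card g.ker = h := hh
  have hrange : (g.range : Set F).ncard = m := by
    have h1 := card_range_mul_card_ker g
    rw [hker, ← hm] at h1
    have h0 : 0 < h := hker ▸ Nat.card_pos
    exact Nat.eq_of_mul_eq_mul_right h0 h1
  refine ⟨_, isRegularParc_of_det (fun d => {y | g y = d.getD 0})
    {d | d.getD 0 ∈ (g.range : Set F)} ?_ ?_ ?_ ?_⟩
  · rw [encard_getD_mem (Set.toFinite _) g.range.zero_mem, hrange]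
  · rintro d ⟨x, hx⟩
    rw [← hx, encard_preimage_singleton, hker]
  · intro d hd
    rw [Set.eq_empty_iff_forall_notMem]
    exact fun y hy => hd ⟨y, hy⟩
  · intro d₀ d₁ d₂ h01 h12 h20 y₀ h₀ y₁ h₁ y₂ h₂
    exact det_ne_zero_of_averaging T g hT hc (fun _ => rfl) h01 h12 h20 h₀ h₁ h₂

/-! ### The trace map -/

theorem ncard_pow_eq_self_le {F : Type*} [Field F] {q : ℕ} (hq : 1 < q) :
    {y : F | y ^ q = y}.Finite ∧ {y : F | y ^ q = y}.ncard ≤ q := by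
  classical
  have hdeg := FiniteField.X_pow_card_sub_X_natDegree_eq F hq
  have h : {y : F | y ^ q = y} =
      ((Polynomial.X ^ q - Polynomial.X : Polynomial F).roots.toFinset : Set F) := by
    ext y
    simp [FiniteField.X_pow_card_sub_X_ne_zero F hq, sub_eq_zero]
  rw [h, Set.ncard_coe_finset]
  exact ⟨Finset.finite_toSet _,
    (Multiset.toFinset_card_le _).trans ((Polynomial.card_roots' _).trans hdeg.le)⟩

theorem theorem5p3 {F : Type*} [Field F] [Finite F] (q : ℕ) (hq : IsPrimePow q) (hq2 : Even q)
    (hF : Nat.card F = q ^ 2) :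
    (∃ K : Set (ProjSpace 2 F), IsRegularParc (q + 1) q K) ∧
    (∃ K : Set (ProjSpace 2 F), IsRegularParc ((q + 2) / 2) (2 * q) K) := by
  obtain ⟨n, hn, rfl⟩ : ∃ n, 0 < n ∧ q = 2 ^ n := by
    obtain ⟨p, n, hp, hn, rfl⟩ := hq
    have h2 := Nat.prime_two.prime.dvd_of_dvd_pow hq2.two_dvd
    exact ⟨n, hn, by rw [(Nat.prime_dvd_prime_iff_eq Nat.prime_two hp.nat_prime).1 h2]⟩
  have := Fintype.ofFinite F
  have hF' : Fintype.card F = (2 ^ n) ^ 2 := by rw [← Nat.card_eq_fintype_card, hF]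
  have : CharP F 2 := charP_of_card_eq_prime_pow (f := n * 2) (by rw [hF', pow_mul])
  have hq1 : 1 < 2 ^ n := Nat.one_lt_two_pow hn.ne'
  have hqq : ∀ y : F, (y ^ 2 ^ n) ^ 2 ^ n = y := fun y => by
    rw [← pow_mul, ← pow_two, ← hF', FiniteField.pow_card]
  -- The trace of `F` over its subfield with `q` elements.
  let T : F →+ F := AddMonoidHom.mk' (fun y => y ^ 2 ^ n + y) fun x y => by
    rw [add_pow_char_pow]
    ring
  have hTdef : ∀ y, T y = y ^ 2 ^ n + y := fun _ => rfl
  have hTfix : ∀ y, T y ^ 2 ^ n = T y := fun y => by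
    rw [hTdef, add_pow_char_pow, hqq, add_comm]
  have hT : ∀ x y, T (T x * y) = T x * T y := fun x y => by
    rw [hTdef (T x * y), mul_pow, hTfix, hTdef y]
    ring
  obtain ⟨hfin, hle⟩ := ncard_pow_eq_self_le (F := F) hq1
  have hTker : ∀ y, T y = 0 ↔ y ^ 2 ^ n = y := fun y => CharTwo.add_eq_zero
  have hker : (T.ker : Set F) = {y | y ^ 2 ^ n = y} := Set.ext hTker
  have hsub : (T.range : Set F) ⊆ {y | y ^ 2 ^ n = y} := by
    rintro _ ⟨y, rfl⟩
    exact hTfix y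
  have hmul : (T.range : Set F).ncard * (T.ker : Set F).ncard = (2 ^ n) ^ 2 :=
    (card_range_mul_card_ker T).trans hF
  have hr := (Set.ncard_le_ncard hsub hfin).trans hle
  have hk : (T.ker : Set F).ncard = 2 ^ n := by
    -- Both factors of `hmul` are at most `q`, hence both are `q`.
    rw [hker] at hmul ⊢
    nlinarith
  have hrange : (T.range : Set F) = {y | y ^ 2 ^ n = y} := by
    refine Set.eq_of_subset_of_ncard_le hsub ?_ hfin
    rw [hk] at hmul
    rw [← hker, hk]
    nlinarith
  obtain ⟨u, hu⟩ : (1 : F) ∈ (T.range : Set F) := by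
    rw [hrange]
    exact one_pow _
  constructor
  -- For `c = 0` the kernel of `T²` is that of `T`.
  · refine exists_isRegularParc_of_averaging T hT (Or.inl rfl) ?_ (by rw [hF, pow_two])
    rw [← hk]
    congr 1
    ext y
    simp
  -- For `c = 1` the kernel of `T² + T` consists of the fibres of `T` over `0` and `1`.
  · have hset : {y | T y * T y + 1 * T y = 0} = (T.ker : Set F) ∪ {y | T y = T u} := by
      ext y
      have : T y * T y + 1 * T y = T y * (T y + 1) := by ring
      rw [Set.mem_ofPred_eq, this, mul_eq_zero, CharTwo.add_eq_zero, ← hu]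
      rfl
    have hcoset : {y | T y = T u}.ncard = 2 ^ n := by
      rw [Set.ncard, encard_preimage_singleton, ENat.toNat_natCast]
      exact hk
    obtain ⟨k, rfl⟩ := Nat.exists_eq_succ_of_ne_zero hn.ne'
    have hm : (2 ^ k.succ + 2) / 2 = 2 ^ k + 1 := by
      rw [pow_succ]
      omega
    rw [hm]
    refine exists_isRegularParc_of_averaging T hT (Or.inr rfl) ?_ (by rw [hF, pow_succ]; ring)
    rw [hset, Set.ncard_union_eq _ (Set.toFinite _) (Set.toFinite _), hk, hcoset, two_mul]
    rw [Set.disjoint_left]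
    intro y hy hy'
    have h0 : T y = 0 := hy
    have h1 : T y = T u := hy'
    rw [h0, hu] at h1
    exact zero_ne_one h1
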